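/- Let $\mathbb{H}$ be the skew field of quaternions, and let $\mathbb{H}[q_1,\ldots,q_n]$ be the ring of slice regular polynomials $P(q_1,\ldots,q_n)=\sum_{\ell} q_1^{\ell_1}\cdots q_n^{\ell_n}a_\ell$ (finite sums over $\ell\in\mathbb{N}^n$, with $a_\ell\in\mathbb{H}$), with the usual addition and the $*$-product $$\Big(\sum_\ell q_1^{\ell_1}\cdots q_n^{\ell_n}a_\ell\Big)*\Big(\sum_m q_1^{m_1}\cdots q_n^{m_n}b_m\Big)=\sum_{k} q_1^{k_1}\cdots q_n^{k_n}\sum_{\ell+m=k}a_\ell b_m .$$ Such a $P$ is evaluated at points of $\mathbb{H}^n$ by ordered substitution in the formula above. Let $\mathbb{S}=\{J\in\mathbb{H}: J^2=-1\}$ and $\mathbb{C}_J=\mathbb{R}+\mathbb{R}J$ for $J\in\mathbb{S}$. For a right ideal $I$ of $\mathbb{H}[q_1,\ldots,q_n]$ put $$\mathcal{V}(I)=\{\mathbf{a}\in\mathbb{H}^n : P(\mathbf{a})=0 \text{ for all } P\in I\},\qquad \mathcal{V}_c(I)=\mathcal{V}(I)\cap\bigcup_{J\in\mathbb{S}}(\mathbb{C}_J)^n,$$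 and for $Z\subseteq\mathbb{H}^n$ let $\mathcal{J}(Z)$ be the right ideal of $\mathbb{H}[q_1,\ldots,q_n]$ generated by the polynomials that vanish at every point of $Z$ (so $\mathcal{J}(\varnothing)=\mathbb{H}[q_1,\ldots,q_n]$). Then, for every right ideal $I$ of $\mathbb{H}[q_1,\ldots,q_n]$, $$\mathcal{J}(\mathcal{V}(I))=\mathcal{J}(\mathcal{V}_c(I)).$$ -/

import Mathlib

open scoped Quaternion

namespace SliceRegular

/-- The ring `ℍ[q₁, …, qₙ]` of slice regular polynomials, given by their coefficients: finitely
supported functions `ℓ ↦ a_ℓ` from multi-indices to `ℍ`, the coefficients being written on the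
right of the monomials. Multiplication is convolution of coefficients, i.e. the `*`-product:
`(q^ℓ a) * (q^m b) = q^(ℓ + m) (a b)`. -/
abbrev SlicePoly (n : ℕ) : Type := AddMonoidAlgebra ℍ[ℝ] (Fin n →₀ ℕ)

/-- The ordered monomial `q₁^ℓ₁ q₂^ℓ₂ ⋯ qₙ^ℓₙ` evaluated at a point of `ℍⁿ`. -/
noncomputable def monomialValue {n : ℕ} (q : Fin n → ℍ[ℝ]) (l : Fin n →₀ ℕ) : ℍ[ℝ] :=
  (List.ofFn fun i => q i ^ l i).prod

/-- The value `P(q₁, …, qₙ) = ∑ q₁^ℓ₁ ⋯ qₙ^ℓₙ a_ℓ`. -/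
noncomputable def value {n : ℕ} (P : SlicePoly n) (q : Fin n → ℍ[ℝ]) : ℍ[ℝ] :=
  P.coeff.sum fun l a => monomialValue q l * a

/-- Right ideals: additive subgroups closed under `Q ↦ Q * P` for every `P`. -/
abbrev RightIdeal (n : ℕ) : Type := Submodule (SlicePoly n)ᵐᵒᵖ (SlicePoly n)

/-- The sphere `𝕊` of imaginary units. -/
def imaginaryUnits : Set ℍ[ℝ] := {q | q ^ 2 = -1}

/-- The slice `ℂ_J = ℝ + ℝ J`. -/
def slice (J : ℍ[ℝ]) : Set ℍ[ℝ] := {q | ∃ x y : ℝ, q = (x : ℍ[ℝ]) + (y : ℍ[ℝ]) * J}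

/-- `𝒱(I)`: the common zeros in `ℍⁿ` of the polynomials in `I`. -/
def zeroLocus {n : ℕ} (I : RightIdeal n) : Set (Fin n → ℍ[ℝ]) :=
  {q | ∀ P ∈ I, value P q = 0}

/-- `𝒱_c(I) = 𝒱(I) ∩ ⋃_{J ∈ 𝕊} (ℂ_J)ⁿ`. -/
def commutingZeroLocus {n : ℕ} (I : RightIdeal n) : Set (Fin n → ℍ[ℝ]) :=
  zeroLocus I ∩ ⋃ J ∈ imaginaryUnits, {q | ∀ i, q i ∈ slice J}

/-- `𝒥(Z)`: the right ideal generated by the polynomials which vanish on `Z`. -/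
noncomputable def vanishingIdeal {n : ℕ} (Z : Set (Fin n → ℍ[ℝ])) : RightIdeal n :=
  Submodule.span (SlicePoly n)ᵐᵒᵖ {P | ∀ q ∈ Z, value P q = 0}

end SliceRegular

/-!
A polynomial that vanishes on `𝒱_c(I)` vanishes on all of `𝒱(I)`, so the two vanishing ideals have
the same generators.

Let `a ∈ 𝒱(I)`. The functional `P ↦ P(a)` is `P ↦ ∑ m_ℓ a_ℓ`, where `m_ℓ = a₁^ℓ₁ ⋯ aₙ^ℓₙ`
(`momentEval`). The variables `qᵢ` are central, so they act on the sequences `m` by shifting the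
index, and for a right ideal `I` the sequences whose functional kills `I` are stable under these
shifts and under left multiplication by `ℍ` (`momentEval_mul_single`, `momentEval_const_mul`). Regard
them as a left vector space over `ℂ ⊆ ℍ`. As `aᵢ` is either real or a root of a real quadratic
polynomial with two distinct complex roots, the `i`-th shift acts on `m` either as a scalar or
through a quadratic polynomial with distinct roots (`exists_shift_relation`). The shifts commute
and are `ℂ`-linear, so `m` is a sum of joint eigensequences, all of them still killing `I`
(the induction in `momentEval_eq_zero`). A joint eigensequence with eigenvalues `w ∈ ℂⁿ` is
`m_ℓ = w^ℓ u` with `u ∈ ℍ`; if `u ≠ 0`, its functional is `u` times the evaluation at the point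
`u⁻¹ w u`, all of whose coordinates lie in the slice of `u⁻¹ i u`
(`momentEval_eq_zero_of_eigen`). That point lies in `𝒱_c(I)`, so the functional kills every
polynomial that vanishes on `𝒱_c(I)`.
-/

namespace SliceRegular

open Quaternion

variable {n : ℕ}

/-! ### Functionals given by sequences of moments -/

/-- The right `ℍ`-linear functional `∑ q^ℓ a_ℓ ↦ ∑ m_ℓ a_ℓ` on slice regular polynomials that takes
the value `m ℓ` at the monomial `q^ℓ`. -/
noncomputable def momentEval (m : (Fin n →₀ ℕ) → ℍ[ℝ]) (P : SlicePoly n) : ℍ[ℝ] :=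
  P.coeff.sum fun l a => m l * a

lemma momentEval_single (m : (Fin n →₀ ℕ) → ℍ[ℝ]) (l : Fin n →₀ ℕ) (a : ℍ[ℝ]) :
    momentEval m (AddMonoidAlgebra.single l a) = m l * a := by
  simp [momentEval]

lemma momentEval_zero (m : (Fin n →₀ ℕ) → ℍ[ℝ]) : momentEval m (0 : SlicePoly n) = 0 := by
  simp [momentEval]

lemma momentEval_add (m : (Fin n →₀ ℕ) → ℍ[ℝ]) (P Q : SlicePoly n) :
    momentEval m (P + Q) = momentEval m P + momentEval m Q := by
  simp only [momentEval, AddMonoidAlgebra.coeff_add]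
  exact Finsupp.sum_add_index' (fun _ => mul_zero _) (fun _ _ _ => mul_add _ _ _)

lemma momentEval_const_mul (c : ℍ[ℝ]) (m : (Fin n →₀ ℕ) → ℍ[ℝ]) (P : SlicePoly n) :
    momentEval (fun l => c * m l) P = c * momentEval m P := by
  simp only [momentEval, Finsupp.sum, Finset.mul_sum, mul_assoc]

lemma momentEval_sub (m m' : (Fin n →₀ ℕ) → ℍ[ℝ]) (P : SlicePoly n) :
    momentEval (fun l => m l - m' l) P = momentEval m P - momentEval m' P := by
  simp only [momentEval, Finsupp.sum, sub_mul, Finset.sum_sub_distrib]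

lemma momentEval_mul_single (m : (Fin n →₀ ℕ) → ℍ[ℝ]) (e : Fin n →₀ ℕ) (P : SlicePoly n) :
    momentEval m (P * AddMonoidAlgebra.single e 1) = momentEval (fun l => m (l + e)) P := by
  induction P using AddMonoidAlgebra.induction_linear with
  | zero => simp [momentEval_zero]
  | add P Q hP hQ => rw [add_mul, momentEval_add, momentEval_add, hP, hQ]
  | single l a =>
    rw [AddMonoidAlgebra.single_mul_single, momentEval_single, momentEval_single, mul_one]

/-- The functionals that kill a right ideal are stable under the shifts of the moments. -/
lemma momentEval_shift_eq_zero {I : RightIdeal n} {m : (Fin n →₀ ℕ) → ℍ[ℝ]}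
    (hm : ∀ Q ∈ I, momentEval m Q = 0) (e : Fin n →₀ ℕ) :
    ∀ Q ∈ I, momentEval (fun l => m (l + e)) Q = 0 := by
  intro Q hQ
  rw [← momentEval_mul_single]
  exact hm _ (I.smul_mem (MulOpposite.op (AddMonoidAlgebra.single e 1)) hQ)

/-! ### Evaluation at a point, and the shift relations of its moments -/

lemma value_eq_momentEval (P : SlicePoly n) (q : Fin n → ℍ[ℝ]) :
    value P q = momentEval (monomialValue q) P := rfl

lemma monomialValue_eq_mkPiAlgebraFin (q : Fin n → ℍ[ℝ]) (l : Fin n →₀ ℕ) :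
    monomialValue q l = MultilinearMap.mkPiAlgebraFin ℝ n ℍ[ℝ] (fun i => q i ^ l i) := by
  rw [MultilinearMap.mkPiAlgebraFin_apply, monomialValue]

lemma pow_add_single (q : Fin n → ℍ[ℝ]) (l : Fin n →₀ ℕ) (i : Fin n) (k : ℕ) :
    (fun j => q j ^ (l + Finsupp.single i k) j) =
      Function.update (fun j => q j ^ l j) i (q i ^ (l i + k)) := by
  funext j
  rcases eq_or_ne j i with rfl | h
  · simp
  · simp [Function.update_of_ne h, Finsupp.single_eq_of_ne h]

/-- The moments of evaluation at `q` inherit every real linear recursion of order two satisfied by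
the powers of the coordinate `q i`. -/
lemma monomialValue_add_two (q : Fin n → ℍ[ℝ]) (i : Fin n) {s t : ℝ}
    (h : q i ^ 2 = s • q i - t • 1) (l : Fin n →₀ ℕ) :
    monomialValue q (l + Finsupp.single i 1 + Finsupp.single i 1) =
      s • monomialValue q (l + Finsupp.single i 1) - t • monomialValue q l := by
  have hl : (fun j => q j ^ l j) = Function.update (fun j => q j ^ l j) i (q i ^ l i) := by simp
  have hp : q i ^ (l i + (1 + 1)) = s • q i ^ (l i + 1) - t • q i ^ l i := by
    rw [pow_add, one_add_one_eq_two, h, mul_sub, mul_smul_comm, mul_smul_comm, mul_one, pow_succ]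
  rw [add_assoc, ← Finsupp.single_add]
  simp only [monomialValue_eq_mkPiAlgebraFin, pow_add_single, hp]
  rw [MultilinearMap.map_update_sub, MultilinearMap.map_update_smul,
    MultilinearMap.map_update_smul, ← hl]

lemma monomialValue_add_one_of_real (q : Fin n → ℍ[ℝ]) (i : Fin n) {t : ℝ}
    (h : q i = (t : ℍ[ℝ])) (l : Fin n →₀ ℕ) :
    monomialValue q (l + Finsupp.single i 1) = t • monomialValue q l := by
  have hl : (fun j => q j ^ l j) = Function.update (fun j => q j ^ l j) i (q i ^ l i) := by simp
  have hp : q i ^ (l i + 1) = t • q i ^ l i := by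
    rw [pow_succ', h, Quaternion.coe_mul_eq_smul]
  simp only [monomialValue_eq_mkPiAlgebraFin, pow_add_single, hp]
  rw [MultilinearMap.map_update_smul, ← hl]

/-- The `i`-th shift acts on `m` through a quadratic polynomial with distinct roots `z, w ∈ ℂ`. -/
def IsSplitAt (m : (Fin n →₀ ℕ) → ℍ[ℝ]) (i : Fin n) : Prop :=
  ∃ z w : ℂ, z ≠ w ∧ ∀ l, m (l + Finsupp.single i 1 + Finsupp.single i 1) =
    ((z + w : ℂ) : ℍ[ℝ]) * m (l + Finsupp.single i 1) - ((z * w : ℂ) : ℍ[ℝ]) * m l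

/-- The `i`-th shift acts on `m` as a scalar in `ℂ ⊆ ℍ`. -/
def IsEigenAt (m : (Fin n →₀ ℕ) → ℍ[ℝ]) (i : Fin n) : Prop :=
  ∃ w : ℂ, ∀ l, m (l + Finsupp.single i 1) = (w : ℍ[ℝ]) * m l

lemma exists_shift_relation (q : Fin n → ℍ[ℝ]) (i : Fin n) :
    IsSplitAt (monomialValue q) i ∨ IsEigenAt (monomialValue q) i := by
  by_cases hq : (q i).im = 0
  · refine Or.inr ⟨((q i).re : ℂ), fun l => ?_⟩
    have h : q i = ((q i).re : ℍ[ℝ]) := by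
      conv_lhs => rw [← Quaternion.re_add_im (q i), hq, add_zero]
    rw [monomialValue_add_one_of_real q i h, Quaternion.coeComplex_coe,
      Quaternion.coe_mul_eq_smul]
  · -- `q i` is conjugate to `x + y i` with `x = re`, `y = |im| > 0`; the roots are `x ± y i`.
    set x := (q i).re
    set y := ‖(q i).im‖ with hy
    have hy0 : y ≠ 0 := norm_ne_zero_iff.mpr hq
    have hy2 : y ^ 2 = (q i).imI ^ 2 + (q i).imJ ^ 2 + (q i).imK ^ 2 := by
      rw [hy, sq, ← Quaternion.normSq_eq_norm_mul_self, Quaternion.normSq_def']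
      simp
    refine Or.inl ⟨⟨x, y⟩, ⟨x, -y⟩, fun h => hy0 ?_, fun l => ?_⟩
    · have := congrArg Complex.im h
      simp only at this
      linarith
    · have h : q i ^ 2 = (2 * x) • q i - (x ^ 2 + y ^ 2) • (1 : ℍ[ℝ]) := by
        rw [hy2, sq]
        ext <;> simp [x] <;> ring
      have hs : (⟨x, y⟩ + ⟨x, -y⟩ : ℂ) = ((2 * x : ℝ) : ℂ) := by
        apply Complex.ext <;> simp [two_mul]
      have hp : (⟨x, y⟩ * ⟨x, -y⟩ : ℂ) = ((x ^ 2 + y ^ 2 : ℝ) : ℂ) := by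
        apply Complex.ext <;> simp only [Complex.mul_re, Complex.mul_im, Complex.ofReal_re,
          Complex.ofReal_im] <;> ring
      rw [monomialValue_add_two q i h, hs, hp, Quaternion.coeComplex_coe,
        Quaternion.coeComplex_coe, Quaternion.coe_mul_eq_smul, Quaternion.coe_mul_eq_smul]

/-! ### Joint eigensequences are multiples of evaluations at commuting points -/

lemma monomialValue_coeComplex (w : Fin n → ℂ) (l : Fin n →₀ ℕ) :
    monomialValue (fun i => (w i : ℍ[ℝ])) l = ((∏ i, w i ^ l i : ℂ) : ℍ[ℝ]) := by
  have hp (z : ℂ) (k : ℕ) : ((z ^ k : ℂ) : ℍ[ℝ]) = (z : ℍ[ℝ]) ^ k :=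
    map_pow Quaternion.ofComplex z k
  rw [← List.prod_ofFn, ← Quaternion.coe_ofComplex, map_list_prod, List.map_ofFn, monomialValue]
  simp only [Function.comp_def, Quaternion.coe_ofComplex, hp]

lemma monomialValue_conj (q : Fin n → ℍ[ℝ]) {u : ℍ[ℝ]} (hu : u ≠ 0) (l : Fin n →₀ ℕ) :
    monomialValue (fun i => u⁻¹ * q i * u) l = u⁻¹ * monomialValue q l * u := by
  let φ : ℍ[ℝ] →* ℍ[ℝ] :=
    MulDistribMulAction.toMonoidHom ℍ[ℝ] (ConjAct.toConjAct (Units.mk0 u hu)⁻¹)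
  have h (x : ℍ[ℝ]) : φ x = u⁻¹ * x * u := by
    simp [φ, ConjAct.units_smul_def]
  simp only [monomialValue, ← h, map_list_prod, List.map_ofFn, Function.comp_def, map_pow]

lemma eq_prod_mul_of_eigen {m : (Fin n →₀ ℕ) → ℍ[ℝ]} {w : Fin n → ℂ}
    (hw : ∀ i l, m (l + Finsupp.single i 1) = (w i : ℍ[ℝ]) * m l) (l : Fin n →₀ ℕ) :
    m l = ((∏ i, w i ^ l i : ℂ) : ℍ[ℝ]) * m 0 := by
  have hpow (l : Fin n →₀ ℕ) (i : Fin n) (k : ℕ) :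
      m (l + Finsupp.single i k) = ((w i ^ k : ℂ) : ℍ[ℝ]) * m l := by
    induction k with
    | zero => simp
    | succ k ih =>
      rw [Finsupp.single_add, ← add_assoc, hw, ih, pow_succ', Quaternion.coeComplex_mul, mul_assoc]
  induction l using Finsupp.induction with
  | zero => simp
  | single_add i k l hi _ ih =>
    have hl : ∏ j, w j ^ (Finsupp.single i k + l) j = w i ^ k * ∏ j, w j ^ l j := by
      simp only [Finsupp.add_apply, pow_add, Finset.prod_mul_distrib]
      simp [Finsupp.single_apply, pow_ite]
    rw [add_comm, hpow, ih, ← mul_assoc, ← Quaternion.coeComplex_mul, ← hl, add_comm]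

lemma conj_mem_commuting (w : Fin n → ℂ) {u : ℍ[ℝ]} (hu : u ≠ 0) :
    (fun i => u⁻¹ * (w i : ℍ[ℝ]) * u) ∈
      ⋃ J ∈ imaginaryUnits, {q : Fin n → ℍ[ℝ] | ∀ i, q i ∈ slice J} := by
  have hI : (Complex.I : ℍ[ℝ]) * (Complex.I : ℍ[ℝ]) = -1 := by
    ext <;> simp
  refine Set.mem_biUnion (x := u⁻¹ * (Complex.I : ℍ[ℝ]) * u) ?_ fun i => ?_
  · change (u⁻¹ * (Complex.I : ℍ[ℝ]) * u) ^ 2 = -1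
    calc (u⁻¹ * (Complex.I : ℍ[ℝ]) * u) ^ 2
        = u⁻¹ * (Complex.I : ℍ[ℝ]) * (u * u⁻¹) * (Complex.I : ℍ[ℝ]) * u := by
          simp only [sq, mul_assoc]
      _ = u⁻¹ * ((Complex.I : ℍ[ℝ]) * (Complex.I : ℍ[ℝ])) * u := by
          rw [mul_inv_cancel₀ hu, mul_one, mul_assoc u⁻¹]
      _ = -1 := by rw [hI, mul_neg, mul_one, neg_mul, inv_mul_cancel₀ hu]
  · refine ⟨(w i).re, (w i).im, ?_⟩
    have hw : (w i : ℍ[ℝ]) = ((w i).re : ℍ[ℝ]) + (w i).im • (Complex.I : ℍ[ℝ]) := by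
      ext <;> simp
    have hc : u⁻¹ * ((w i).re : ℍ[ℝ]) * u = ((w i).re : ℍ[ℝ]) := by
      rw [mul_assoc, Quaternion.coe_commutes, ← mul_assoc, inv_mul_cancel₀ hu, one_mul]
    rw [Quaternion.coe_mul_eq_smul]
    conv_lhs => rw [hw, mul_add, add_mul, hc, mul_smul_comm, smul_mul_assoc]

lemma momentEval_eq_zero_of_eigen {I : RightIdeal n} {P : SlicePoly n}
    (hP : ∀ q ∈ commutingZeroLocus I, value P q = 0) {m : (Fin n →₀ ℕ) → ℍ[ℝ]}
    (hm : ∀ Q ∈ I, momentEval m Q = 0) (he : ∀ i, IsEigenAt m i) : momentEval m P = 0 := by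
  choose w hw using he
  have hml : ∀ l, m l = monomialValue (fun i => (w i : ℍ[ℝ])) l * m 0 := fun l => by
    rw [monomialValue_coeComplex]
    exact eq_prod_mul_of_eigen hw l
  by_cases hu : m 0 = 0
  · have : m = fun l => 0 * m l := by
      funext l
      rw [hml l, hu, mul_zero, mul_zero]
    rw [this, momentEval_const_mul, zero_mul]
  · have hval (Q : SlicePoly n) :
        momentEval m Q = m 0 * value Q fun i => (m 0)⁻¹ * (w i : ℍ[ℝ]) * m 0 := by
      rw [value_eq_momentEval, ← momentEval_const_mul]
      congr 1
      funext l
      rw [monomialValue_conj _ hu, mul_assoc (m 0)⁻¹, mul_inv_cancel_left₀ hu, ← hml]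
    rw [hval, hP _ ⟨fun Q hQ => ?_, conj_mem_commuting w hu⟩, mul_zero]
    exact (mul_eq_zero.mp ((hval Q).symm.trans (hm Q hQ))).resolve_left hu

/-! ### Simultaneous diagonalization of the shifts -/

/-- The component of `m` in the eigenspace of the `i`-th shift for one of the two roots, up to a
scalar: the shift minus the other root `w`. -/
noncomputable def component (m : (Fin n →₀ ℕ) → ℍ[ℝ]) (i : Fin n) (w : ℂ) (l : Fin n →₀ ℕ) : ℍ[ℝ] :=
  m (l + Finsupp.single i 1) - (w : ℍ[ℝ]) * m l

lemma coeComplex_left_comm (z w : ℂ) (a : ℍ[ℝ]) :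
    (z : ℍ[ℝ]) * ((w : ℍ[ℝ]) * a) = (w : ℍ[ℝ]) * ((z : ℍ[ℝ]) * a) := by
  rw [← mul_assoc, ← Quaternion.coeComplex_mul, mul_comm z, Quaternion.coeComplex_mul, mul_assoc]

lemma IsEigenAt.component {m : (Fin n →₀ ℕ) → ℍ[ℝ]} {j : Fin n} (h : IsEigenAt m j) (i : Fin n)
    (w : ℂ) : IsEigenAt (component m i w) j := by
  obtain ⟨v, hv⟩ := h
  refine ⟨v, fun l => ?_⟩
  simp only [SliceRegular.component]
  rw [add_right_comm, hv, hv, mul_sub, coeComplex_left_comm]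

lemma IsSplitAt.component {m : (Fin n →₀ ℕ) → ℍ[ℝ]} {j : Fin n} (h : IsSplitAt m j) (i : Fin n)
    (w : ℂ) : IsSplitAt (component m i w) j := by
  obtain ⟨v, v', hne, hv⟩ := h
  refine ⟨v, v', hne, fun l => ?_⟩
  simp only [SliceRegular.component]
  rw [add_right_comm _ _ (Finsupp.single i 1), add_right_comm _ _ (Finsupp.single i 1), hv, hv,
    mul_sub, mul_sub, mul_sub, coeComplex_left_comm w, coeComplex_left_comm w]
  abel

lemma isEigenAt_component {m : (Fin n →₀ ℕ) → ℍ[ℝ]} {i : Fin n} {z w : ℂ}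
    (h : ∀ l, m (l + Finsupp.single i 1 + Finsupp.single i 1) =
      ((z + w : ℂ) : ℍ[ℝ]) * m (l + Finsupp.single i 1) - ((z * w : ℂ) : ℍ[ℝ]) * m l) :
    IsEigenAt (component m i w) i := by
  refine ⟨z, fun l => ?_⟩
  simp only [component]
  rw [h, Quaternion.coeComplex_add, Quaternion.coeComplex_mul]
  noncomm_ring

/-- Induction on the set `s` of variables whose shifts are not known to act as scalars. -/
lemma momentEval_eq_zero {I : RightIdeal n} {P : SlicePoly n}
    (hP : ∀ q ∈ commutingZeroLocus I, value P q = 0) (s : Finset (Fin n)) :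
    ∀ m : (Fin n →₀ ℕ) → ℍ[ℝ], (∀ Q ∈ I, momentEval m Q = 0) →
      (∀ i, IsSplitAt m i ∨ IsEigenAt m i) → (∀ i ∉ s, IsEigenAt m i) → momentEval m P = 0 := by
  induction s using Finset.induction_on with
  | empty => exact fun m hm _ he => momentEval_eq_zero_of_eigen hP hm fun i => he i (by simp)
  | insert i s _ ih =>
    intro m hm hsplit he
    rcases hsplit i with ⟨z, w, hne, hzw⟩ | hi
    · have hcomp (v : ℂ) (Q : SlicePoly n) : momentEval (component m i v) Q =
          momentEval (fun l => m (l + Finsupp.single i 1)) Q - (v : ℍ[ℝ]) * momentEval m Q := by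
        rw [← momentEval_const_mul, ← momentEval_sub]
        rfl
      have key (v : ℂ) (hv : IsEigenAt (component m i v) i) :
          momentEval (component m i v) P = 0 := by
        refine ih _ (fun Q hQ => ?_) (fun j => ?_) fun j hj => ?_
        · rw [hcomp, momentEval_shift_eq_zero hm _ Q hQ, hm Q hQ, mul_zero, sub_zero]
        · exact (hsplit j).imp (·.component i v) (·.component i v)
        · rcases eq_or_ne j i with rfl | hji
          · exact hv
          · exact (he j (by simp [hji, hj])).component i v
      have hw := key w (isEigenAt_component hzw)
      have hz := key z (isEigenAt_component fun l => by rw [hzw l, add_comm z w, mul_comm z w])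
      -- The two components differ by `(z - w) m`.
      rw [hcomp, sub_eq_zero] at hw hz
      rw [hw, ← sub_eq_zero, ← sub_mul, mul_eq_zero, sub_eq_zero] at hz
      refine hz.resolve_left fun h => hne ?_
      exact Complex.ext (by simpa using (congrArg QuaternionAlgebra.re h).symm)
        (by simpa using (congrArg QuaternionAlgebra.imI h).symm)
    · refine ih m hm hsplit fun j hj => ?_
      rcases eq_or_ne j i with rfl | hji
      · exact hi
      · exact he j (by simp [hji, hj])

theorem value_eq_zero_of_mem_zeroLocus {I : RightIdeal n} {P : SlicePoly n}
    (hP : ∀ q ∈ commutingZeroLocus I, value P q = 0) {a : Fin n → ℍ[ℝ]} (ha : a ∈ zeroLocus I) :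
    value P a = 0 :=
  momentEval_eq_zero hP Finset.univ _ ha (exists_shift_relation a) (by simp)

end SliceRegular

theorem corollary4p2 (n : ℕ) (I : SliceRegular.RightIdeal n) :
    SliceRegular.vanishingIdeal (SliceRegular.zeroLocus I) =
      SliceRegular.vanishingIdeal (SliceRegular.commutingZeroLocus I) := by
  refine congrArg (Submodule.span _)
    (Set.ext fun P => ⟨fun hP q hq => hP q hq.1, fun hP q hq => ?_⟩)
  exact SliceRegular.value_eq_zero_of_mem_zeroLocus hP hq
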